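/- Let $0\le k\le n$, let $S\subseteq\mathbb R^n$ be a $k$-dimensional $C^1$ (embedded) submanifold with surface measure $\sigma$ (the normalised $k$-dimensional Hausdorff measure on $S$), let $g:S\to\mathbb C$ be $\sigma$-integrable, and let $$\widehat{gd\sigma}(x)=\int_S g(\xi)e^{-2\pi i x\cdot\xi}\,d\sigma(\xi),\qquad x\in\mathbb R^n .$$ For $0\le m\le n$ let $\mathfrak M_{m,n}$ be the manifold of affine $m$-planes $\pi+\{y\}$ of $\mathbb R^n$, parametrised by the $m$-dimensional subspaces $\pi$ of $\mathbb R^n$ and $y\in\pi^\perp$. For measurable $f:\mathbb R^n\to[0,\infty]$ write $$T_{m,n}f(\pi,y)=\int_\pi f(x+y)\,d\lambda_\pi(x),$$ where $\lambda_\pi$ is Lebesgue measure on $\pi$; and for measurable $u:\mathfrak M_{k,n}\to[0,\infty)$ let $$T_{k,n}^*u(x)=\int u\big(\pi,P_{\pi^\perp}x\big)\,d\gamma(\pi)\in[0,\infty],\qquad x\in\mathbb R^n,$$ be the adjoint $k$-plane transform, where $\gamma$ is the rotation-invariant probability measure on the Grassmannian of $k$-dimensional subspaces of $\mathbb R^n$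 and $P_{\pi^\perp}$ is the orthogonal projection onto $\pi^\perp$. Suppose that $u:\mathfrak M_{k,n}\to[0,\infty)$ is measurable and that, for every $(\pi,y)$ with $u(\pi,y)\neq0$, $$\text{(T)}\quad T_\xi S\cap\pi^\perp=\{0\}\ \text{ for all }\xi\in S,\qquad\qquad \text{(GT)}\quad \langle\xi-\eta\rangle\cap\pi^\perp=\{0\}\ \text{ for all }\xi,\eta\in S,$$ where $\langle\xi-\eta\rangle$ is the linear span of $\xi-\eta$. If $w=T^*_{k,n}u$, then $$\int_{\mathbb R^n}|\widehat{gd\sigma}(x)|^2\,w(x)\,dx=\int_S|g(\xi)|^2\,\sup_{y\in T_\xi S}T_{n-k,n}w\big((T_\xi S)^\perp,y\big)\,d\sigma(\xi),$$ as an identity between elements of $[0,\infty]$. -/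

import Mathlib

open MeasureTheory Set Topology
open scoped ENNReal NNReal RealInnerProductSpace

noncomputable section

namespace KPlane

/-- Euclidean space `ℝⁿ`. -/
abbrev Eucl (n : ℕ) : Type := EuclideanSpace ℝ (Fin n)

/-! ### Submanifolds, tangent spaces, surface measure and the extension operator -/

/-- `ψ`, restricted to the open set `U ⊆ ℝᵏ`, is a `C¹` parametrisation of a relatively open piece
of `S`: it is an injective `C¹` immersion and a homeomorphism onto a relatively open subset
of `S` (it carries open subsets of `U` to relatively open subsets of `S`). -/
structure IsLocalParam {k n : ℕ} (S : Set (Eucl n)) (U : Set (Eucl k)) (ψ : Eucl k → Eucl n) :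
    Prop where
  isOpen : IsOpen U
  contDiffOn : ContDiffOn ℝ 1 ψ U
  immersion : ∀ x ∈ U, Function.Injective (fderiv ℝ ψ x)
  injOn : InjOn ψ U
  image_open : ∀ O ⊆ U, IsOpen O → ∃ W : Set (Eucl n), IsOpen W ∧ ψ '' O = S ∩ W

/-- `S` is a `k`-dimensional (embedded) `C¹` submanifold of `ℝⁿ`. -/
def IsC1Submanifold {n : ℕ} (k : ℕ) (S : Set (Eucl n)) : Prop :=
  ∀ ξ ∈ S, ∃ (U : Set (Eucl k)) (ψ : Eucl k → Eucl n), IsLocalParam S U ψ ∧ ξ ∈ ψ '' U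

/-- The tangent space `T_ξ S`: the space (spanned by the) velocities at `ξ` of curves in `S`. -/
def tangentSpace {n : ℕ} (S : Set (Eucl n)) (ξ : Eucl n) : Submodule ℝ (Eucl n) :=
  Submodule.span ℝ
    {v | ∃ γ : ℝ → Eucl n, (∀ t, γ t ∈ S) ∧ γ 0 = ξ ∧ HasDerivAt γ v 0}

/-- Surface measure on a `k`-dimensional `S ⊆ ℝⁿ`: the `k`-dimensional Hausdorff measure,
normalised so as to agree with Lebesgue measure on `ℝᵏ`, restricted to `S`. -/
def surfaceMeasure {n : ℕ} (k : ℕ) (S : Set (Eucl n)) : Measure (Eucl n) :=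
  (Measure.euclideanHausdorffMeasure k).restrict S

/-- The Fourier extension operator, `x ↦ ∫ g(ξ) e^{-2πi x·ξ} dσ(ξ)`. -/
def extension {n : ℕ} (σ : Measure (Eucl n)) (g : Eucl n → ℂ) (x : Eucl n) : ℂ :=
  ∫ ξ, g ξ * Complex.exp (-(2 * Real.pi * Complex.I * (⟪x, ξ⟫ : ℝ))) ∂σ

/-! ### Grassmannians and plane transforms -/

/-- The Grassmannian of `k`-dimensional linear subspaces of `ℝⁿ`. -/
def LinGrass (k n : ℕ) : Type :=
  {V : Submodule ℝ (Eucl n) // Module.finrank ℝ V = k}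

/-- The Borel `σ`-algebra of the usual topology of the Grassmannian, which is the one that makes
`V ↦ (orthogonal projection onto V)` an embedding into the space of linear operators. -/
instance LinGrass.instMeasurableSpace (k n : ℕ) : MeasurableSpace (LinGrass k n) :=
  MeasurableSpace.comap (fun V => V.1.starProjection)
    (inferInstance : MeasurableSpace (Eucl n →L[ℝ] Eucl n))

/-- The manifold of affine `k`-planes of `ℝⁿ`: the plane `π + {y}` is parametrised by
its direction `π`, a `k`-dimensional subspace, and the translation parameter `y ∈ πᗮ`. -/
def AffGrass (k n : ℕ) : Type :=
  {p : LinGrass k n × Eucl n // p.2 ∈ p.1.1ᗮ}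

instance AffGrass.instMeasurableSpace (k n : ℕ) : MeasurableSpace (AffGrass k n) :=
  Subtype.instMeasurableSpace

/-- The orthogonal group `O(n)`. -/
abbrev OrthGroup (n : ℕ) : Type := unitary (Eucl n →L[ℝ] Eucl n)

instance instContinuousStar (n : ℕ) : ContinuousStar (Eucl n →L[ℝ] Eucl n) :=
  ⟨(ContinuousLinearMap.adjoint (𝕜 := ℝ) (E := Eucl n) (F := Eucl n)).continuous⟩

instance OrthGroup.instCompactSpace (n : ℕ) : CompactSpace (OrthGroup n) := by
  apply isCompact_iff_compactSpace.mp
  have : ProperSpace (Eucl n →L[ℝ] Eucl n) := FiniteDimensional.proper ℝ _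
  refine Metric.isCompact_of_isClosed_isBounded isClosed_unitary ?_
  refine (Metric.isBounded_closedBall (x := (0 : Eucl n →L[ℝ] Eucl n)) (r := 1)).subset ?_
  intro Q hQ
  rw [mem_closedBall_zero_iff]
  refine ContinuousLinearMap.opNorm_le_bound _ zero_le_one fun x => ?_
  rw [one_mul]
  exact ((Unitary.linearIsometryEquiv ⟨Q, hQ⟩).norm_map x).le

/-- The Haar probability measure on `O(n)`. -/
def haarOrth (n : ℕ) : Measure (OrthGroup n) :=
  Measure.haarMeasure ⊤

/-- The action of `O(n)` on the Grassmannian, `(Q, V) ↦ Q(V)`. -/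
def rotate {k n : ℕ} (Q : OrthGroup n) (V : LinGrass k n) : LinGrass k n :=
  ⟨V.1.map (Unitary.linearIsometryEquiv Q).toLinearEquiv.toLinearMap,
    (LinearEquiv.finrank_map_eq (Unitary.linearIsometryEquiv Q).toLinearEquiv V.1).trans V.2⟩

/-- The span of the first `k` vectors of the standard basis of `ℝⁿ`. -/
def coordPlane {k n : ℕ} (hk : k ≤ n) : LinGrass k n :=
  ⟨Submodule.span ℝ (Set.range fun i : Fin k =>
      EuclideanSpace.basisFun (Fin n) ℝ (Fin.castLE hk i)), by
    have h := (EuclideanSpace.basisFun (Fin n) ℝ).orthonormal.linearIndependent.comp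
      (Fin.castLE hk) (Fin.castLE_injective hk)
    exact (finrank_span_eq_card h).trans (Fintype.card_fin k)⟩

theorem rotate_starProjection {k n : ℕ} (Q : OrthGroup n) (V : LinGrass k n) :
    (rotate Q V).1.starProjection = Q.1 * V.1.starProjection * star Q.1 := by
  ext1 x
  exact Submodule.starProjection_map_apply (Unitary.linearIsometryEquiv Q) V.1 x

theorem measurable_rotate {k n : ℕ} (V : LinGrass k n) :
    Measurable fun Q : OrthGroup n => rotate Q V := by
  rw [measurable_comap_iff]
  have h : Continuous fun Q : OrthGroup n => Q.1 * V.1.starProjection * star Q.1 := by fun_prop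
  convert h.measurable using 1
  funext Q
  exact rotate_starProjection Q V

/-- The `O(n)`-invariant probability measure on the Grassmannian, i.e. the law of `Q(V₀)` for
`Q` Haar distributed in `O(n)`. -/
def grassMeasure {k n : ℕ} (hk : k ≤ n) : Measure (LinGrass k n) :=
  (haarOrth n).map fun Q => rotate Q (coordPlane hk)

instance grassMeasure.instIsProbabilityMeasure {k n : ℕ} (hk : k ≤ n) :
    IsProbabilityMeasure (grassMeasure hk) := by
  have : IsProbabilityMeasure (haarOrth n) := ⟨Measure.haarMeasure_self⟩
  exact Measure.isProbabilityMeasure_map (measurable_rotate _).aemeasurable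

/-- The `k`-plane transform of `f : ℝⁿ → [0,∞]` at the plane `π + {y}`, where `k = dim π`:
the integral `∫_π f(x + y) dλ_π(x)` with respect to Lebesgue measure on `π`. -/
def planeTransform {n : ℕ} (f : Eucl n → ℝ≥0∞) (V : Submodule ℝ (Eucl n)) (y : Eucl n) : ℝ≥0∞ :=
  ∫⁻ x : V, f (x + y)

/-- The affine `k`-plane with direction `V` that passes through `x`. -/
def planeThrough {k n : ℕ} (V : LinGrass k n) (x : Eucl n) : AffGrass k n :=
  ⟨(V, V.1ᗮ.starProjection x), V.1ᗮ.starProjection_apply_mem x⟩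

/-- The adjoint `k`-plane transform `T*_{k,n} u`: at `x`, the average of `u` over the affine
`k`-planes through `x`, that is, the superposition of the Dirac masses `δ_{π+{y}}` with weights
`u(π, y)`, with respect to Lebesgue measure in `y ∈ πᗮ` and the invariant measure in `π`. -/
def adjointPlaneTransform {k n : ℕ} (hk : k ≤ n) (u : AffGrass k n → ℝ≥0) (x : Eucl n) : ℝ≥0∞ :=
  ∫⁻ V, (u (planeThrough V x) : ℝ≥0∞) ∂(grassMeasure hk)

/-! ### Transversality -/

/-- Every tangent space of `S` meets `πᗮ` trivially. -/
def TransverseLocal {n : ℕ} (S : Set (Eucl n)) (V : Submodule ℝ (Eucl n)) : Prop :=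
  ∀ ξ ∈ S, tangentSpace S ξ ⊓ Vᗮ = ⊥

/-- Every line through two points of `S`, translated to the origin, meets `πᗮ` trivially. -/
def TransverseGlobal {n : ℕ} (S : Set (Eucl n)) (V : Submodule ℝ (Eucl n)) : Prop :=
  ∀ ξ ∈ S, ∀ η ∈ S, Submodule.span ℝ {ξ - η} ⊓ Vᗮ = ⊥

end KPlane

end

/-!
Write `J(V, T)` for the factor by which the orthogonal projection `T → V` between subspaces of the
same dimension changes volumes (`projJacobian`), and let `V` be a `k`-dimensional subspace for which
both transversality conditions hold.

The projection of `S` to `V` is then injective, and an immersion. By the area formula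
(`comap_projTo_volume`) it pulls Lebesgue measure on `V` back to `J(V, T_ξ S) dσ(ξ)`. On a translate
`V + y` the extension of `g` is therefore the Fourier transform of a function on `V`, namely of the
density of the projection of `g e^{-2πi y·ξ} dσ`, and Plancherel's identity
(`lintegral_enorm_fourier_sq`, which holds in `[0, ∞]` for every integrable function) gives
`∫_{V + y} |ĝdσ|² = ∫_S |g(ξ)|² / J(V, T_ξ S) dσ(ξ)`; see `lintegral_enorm_extension_sq`. The right
side does not depend on `y`. Integration against `u` over all planes `V + y` expresses the left side
of the theorem through the numbers `U(V) = ∫_{Vᗮ} u(V, y) dy` (`directionWeight`) alone, as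
`∫ U(V) ∫_S |g(ξ)|² / J(V, T_ξ S) dσ(ξ) dγ(V)`.

On the other side, the integral of `T* u` over a translate of `(T_ξ S)ᗮ` is an average over `V` of
integrals over translates of `(T_ξ S)ᗮ` of functions of the projection to `Vᗮ`. The projection
`(T_ξ S)ᗮ → Vᗮ` has the same Jacobian as `T_ξ S → V` (`normDet_domRestrict_orthogonal`), because
complementary blocks of an orthogonal matrix have determinants of the same absolute value. Hence
that integral is `∫ U(V) / J(V, T_ξ S) dγ(V)` for every translate
(`planeTransform_adjointPlaneTransform`), and the theorem is Tonelli's theorem.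

The area formula is proved by comparing measures locally. Near `ξ ∈ S`, both the surface measure and
the Lebesgue measure of the projection to `V` are, up to a factor close to `1`, constant multiples
of Lebesgue measure in a chart, since a strictly differentiable immersion is almost an affine map on
small sets and Hausdorff measure responds to Lipschitz maps; a countable cover makes this global
(`measure_le_of_forall_nhds`), and the factor tends to `1`.
-/

/-! ### Plancherel's identity for integrable functions -/

namespace KPlane
section Plancherel
open scoped FourierTransform SchwartzMap ContDiff

variable {V : Type*} [NormedAddCommGroup V] [InnerProductSpace ℝ V] [FiniteDimensional ℝ V]
  [MeasurableSpace V] [BorelSpace V]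

theorem integral_schwartz_mul_fourier_eq_flip {f : V → ℂ} (hf : Integrable f) (φ : 𝓢(V, ℂ)) :
    ∫ x, 𝓕 φ x • f x = ∫ x, φ x • 𝓕 f x := by
  simpa using! VectorFourier.integral_fourierIntegral_smul_eq_flip (L := innerₗ V)
      Real.continuous_fourierChar continuous_inner (φ.integrable (μ := volume)) hf

theorem ae_eq_of_integral_schwartz_mul_eq {f h : V → ℂ} (hf : LocallyIntegrable f)
    (hh : LocallyIntegrable h) (H : ∀ φ : 𝓢(V, ℂ), ∫ x, φ x • f x = ∫ x, φ x • h x) :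
    f =ᵐ[volume] h := by
  refine ae_eq_of_integral_contDiff_smul_eq hf hh fun g g_smooth g_cpt => ?_
  have hg₁ : HasCompactSupport (Complex.ofRealCLM ∘ g) := g_cpt.comp_left rfl
  have hg₂ : ContDiff ℝ ∞ (Complex.ofRealCLM ∘ g) := by fun_prop
  simpa using! H (hg₁.toSchwartzMap hg₂)

theorem continuous_fourier_of_integrable {f : V → ℂ} (hf : Integrable f) : Continuous (𝓕 f) :=
  VectorFourier.fourierIntegral_continuous (L := innerₗ V) Real.continuous_fourierChar
    continuous_inner hf

/-- The Fourier integral agrees with the Fourier transform on `L²`, since both agree as tempered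
distributions. -/
theorem fourier_ae_eq_Lp_fourier {f : V → ℂ} (hf : Integrable f) (hf2 : MemLp f 2) :
    𝓕 f =ᵐ[volume] (𝓕 (hf2.toLp f) : Lp ℂ 2 (volume : Measure V)) := by
  refine ae_eq_of_integral_schwartz_mul_eq (continuous_fourier_of_integrable hf).locallyIntegrable
    ((Lp.memLp _).locallyIntegrable one_le_two) fun φ => ?_
  have h := congrArg (fun T => T φ) (Lp.fourier_toTemperedDistribution_eq (hf2.toLp f))
  simp only [TemperedDistribution.fourier_apply, Lp.toTemperedDistribution_apply] at h
  rw [← h, ← integral_schwartz_mul_fourier_eq_flip hf]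
  refine integral_congr_ae ?_
  filter_upwards [hf2.coeFn_toLp] with x hx
  rw [hx]

/-- An integrable function whose Fourier integral is in `L²` is the `L²` inverse transform of it; in
particular it is itself in `L²`. -/
theorem ae_eq_Lp_fourierInv_fourier {f : V → ℂ} (hf : Integrable f) (hf2 : MemLp (𝓕 f) 2) :
    f =ᵐ[volume] (𝓕⁻ (hf2.toLp (𝓕 f)) : Lp ℂ 2 (volume : Measure V)) := by
  refine ae_eq_of_integral_schwartz_mul_eq hf.locallyIntegrable
    ((Lp.memLp _).locallyIntegrable one_le_two) fun φ => ?_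
  have h := congrArg (fun T => T φ) (Lp.fourierInv_toTemperedDistribution_eq (hf2.toLp (𝓕 f)))
  simp only [TemperedDistribution.fourierInv_apply, Lp.toTemperedDistribution_apply] at h
  rw [← h]
  have h2 := integral_schwartz_mul_fourier_eq_flip hf (𝓕⁻ φ)
  rw [FourierTransform.fourier_fourierInv_eq] at h2
  rw [h2]
  refine integral_congr_ae ?_
  filter_upwards [hf2.coeFn_toLp] with x hx
  rw [hx]

/-- Plancherel's identity for an integrable function, as an identity in `[0, ∞]`: one side is
finite as soon as the other one is. -/
theorem lintegral_enorm_fourier_sq {f : V → ℂ} (hf : Integrable f) :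
    ∫⁻ x, ‖𝓕 f x‖ₑ ^ 2 = ∫⁻ x, ‖f x‖ₑ ^ 2 := by
  suffices h : eLpNorm (𝓕 f) 2 volume = eLpNorm f 2 volume by
    have key : ∀ h : V → ℂ, ∫⁻ x, ‖h x‖ₑ ^ 2 = eLpNorm h 2 volume ^ 2 := fun h => by
      have := eLpNorm_nnreal_pow_eq_lintegral (f := h) (μ := volume) (p := 2) two_ne_zero
      simpa using this.symm
    rw [key, key, h]
  by_cases hf2 : MemLp f 2
  · rw [eLpNorm_congr_ae (fourier_ae_eq_Lp_fourier hf hf2),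
      ← eLpNorm_congr_ae hf2.coeFn_toLp, ← Lp.enorm_def, ← Lp.enorm_def, ← ofReal_norm,
      ← ofReal_norm, Lp.norm_fourier_eq]
  · by_cases hF2 : MemLp (𝓕 f) 2
    · exact absurd ((memLp_congr_ae (ae_eq_Lp_fourierInv_fourier hf hF2)).2 (Lp.memLp _)) hf2
    · have h1 : eLpNorm f 2 volume = ⊤ := by
        by_contra h
        exact hf2 ⟨hf.1, lt_top_iff_ne_top.2 h⟩
      have h2 : eLpNorm (𝓕 f) 2 volume = ⊤ := by
        by_contra h
        exact hF2 ⟨(continuous_fourier_of_integrable hf).aestronglyMeasurable,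
          lt_top_iff_ne_top.2 h⟩
      rw [h1, h2]

end Plancherel
end KPlane

/-! ### Projections between subspaces and integration over orthogonal slices -/

namespace KPlane
section LinearAlgebra
open Module Matrix

/-- Complementary diagonal blocks of an orthogonal matrix have determinants of the same absolute
value. -/
theorem abs_det_block_eq_of_orthogonal {ι κ : Type*} [Fintype ι] [Fintype κ] [DecidableEq ι]
    [DecidableEq κ] {A : Matrix ι ι ℝ} {B : Matrix ι κ ℝ} {C : Matrix κ ι ℝ} {D : Matrix κ κ ℝ}
    (h : fromBlocks A B C D ∈ Matrix.orthogonalGroup (ι ⊕ κ) ℝ) : |A.det| = |D.det| := by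
  have h1 := (Matrix.mem_orthogonalGroup_iff _ _).1 h
  have hdet : |(fromBlocks A B C D).det| = 1 := by
    have := congrArg Matrix.det h1
    rw [Matrix.det_mul, Matrix.det_transpose, Matrix.det_one] at this
    have h2 := congrArg abs this
    rw [abs_mul, abs_one] at h2
    nlinarith [abs_nonneg (fromBlocks A B C D).det]
  rw [fromBlocks_transpose, fromBlocks_multiply, ← fromBlocks_one,
    fromBlocks_inj] at h1
  -- The first block column of `Mᵀ` is the first block column of the second factor, so that
  -- `M * Mᵀ = 1` determines the first block column of the product.
  have h3 : fromBlocks A B C D * fromBlocks Aᵀ 0 Bᵀ 1 = fromBlocks 1 B 0 D := by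
    rw [fromBlocks_multiply, h1.1, h1.2.2.1]
    simp
  have h4 := congrArg (fun M => |M.det|) h3
  simp only [Matrix.det_mul, abs_mul, hdet, det_fromBlocks_zero₁₂, det_fromBlocks_zero₂₁,
    det_transpose, Matrix.det_one, mul_one, one_mul] at h4
  exact h4

variable {E : Type*} [NormedAddCommGroup E] [InnerProductSpace ℝ E] [FiniteDimensional ℝ E]

/-- In orthonormal bases, the projection `T → V` has the matrix of inner products. -/
theorem normDet_domRestrict_starProjection {ι : Type*} [Fintype ι] [DecidableEq ι]
    {V T : Submodule ℝ E} (bV : OrthonormalBasis ι ℝ V) (bT : OrthonormalBasis ι ℝ T) :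
    (V.starProjection.toLinearMap.domRestrict T).normDet =
      |(Matrix.of fun i j => ⟪(bV i : E), (bT j : E)⟫).det| := by
  have hmem : ∀ c, V.starProjection.toLinearMap.domRestrict T c ∈ V := fun c =>
    V.starProjection_apply_mem _
  rw [← LinearMap.normDet_codRestrict hmem, LinearMap.normDet_eq_norm_det_toMatrix _ bT bV,
    Real.norm_eq_abs]
  congr 2
  ext i j
  rw [LinearMap.toMatrix_apply, OrthonormalBasis.coe_toBasis_repr_apply,
    OrthonormalBasis.repr_apply_apply, Submodule.coe_inner, OrthonormalBasis.coe_toBasis,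
    Matrix.of_apply]
  change ⟪(bV i : E), V.starProjection (bT j : E)⟫ = _
  rw [← Submodule.inner_starProjection_left_eq_right,
    Submodule.starProjection_eq_self_iff.2 (bV i).2]

/-- The volume distortion of the orthogonal projection `T → V` between subspaces of the same
dimension is that of the projection `Tᗮ → Vᗮ` between their orthogonal complements. -/
theorem normDet_domRestrict_orthogonal {V T : Submodule ℝ E} (h : finrank ℝ T = finrank ℝ V) :
    (Vᗮ.starProjection.toLinearMap.domRestrict Tᗮ).normDet =
      (V.starProjection.toLinearMap.domRestrict T).normDet := by
  have h' : finrank ℝ Tᗮ = finrank ℝ Vᗮ := by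
    have h1 := T.finrank_add_finrank_orthogonal
    have h2 := V.finrank_add_finrank_orthogonal
    omega
  let bV := stdOrthonormalBasis ℝ V
  let bT := (stdOrthonormalBasis ℝ T).reindex (finCongr h)
  let bV' := stdOrthonormalBasis ℝ Vᗮ
  let bT' := (stdOrthonormalBasis ℝ Tᗮ).reindex (finCongr h')
  rw [normDet_domRestrict_starProjection bV bT, normDet_domRestrict_starProjection bV' bT']
  let cV := (bV.prod bV').map V.orthogonalDecomposition.symm
  let cT := (bT.prod bT').map T.orthogonalDecomposition.symm
  have hM := cV.toMatrix_orthonormalBasis_mem_orthogonal cT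
  have hb : cV.toBasis.toMatrix cT = fromBlocks
      (Matrix.of fun i j => ⟪(bV i : E), (bT j : E)⟫)
      (Matrix.of fun i j => ⟪(bV i : E), (bT' j : E)⟫)
      (Matrix.of fun i j => ⟪(bV' i : E), (bT j : E)⟫)
      (Matrix.of fun i j => ⟪(bV' i : E), (bT' j : E)⟫) := by
    ext i j
    rw [Basis.toMatrix_apply, OrthonormalBasis.coe_toBasis_repr_apply,
      OrthonormalBasis.repr_apply_apply]
    rcases i with i | i <;> rcases j with j | j <;> simp [cV, cT]
  rw [hb] at hM
  exact (abs_det_block_eq_of_orthogonal hM).symm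

theorem normDet_domRestrict_ne_zero {V T : Submodule ℝ E} (h : T ⊓ Vᗮ = ⊥) :
    (V.starProjection.toLinearMap.domRestrict T).normDet ≠ 0 := by
  rw [Ne, LinearMap.normDet_eq_zero_iff_ker_ne_bot, not_not, LinearMap.ker_eq_bot']
  intro x hx
  have : (x : E) ∈ T ⊓ Vᗮ := ⟨x.2, by
    simpa [Submodule.starProjection_apply_eq_zero_iff] using hx⟩
  rw [h] at this
  exact Subtype.ext this

end LinearAlgebra

section Slicing
open Module

variable {E : Type*} [NormedAddCommGroup E] [InnerProductSpace ℝ E] [FiniteDimensional ℝ E]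
  [MeasurableSpace E] [BorelSpace E]

/-- Fubini's theorem for the orthogonal decomposition `E = V ⊕ Vᗮ`. -/
theorem lintegral_eq_lintegral_slices (V : Submodule ℝ E) {F : E → ℝ≥0∞} (hF : Measurable F) :
    ∫⁻ x, F x = ∫⁻ y : Vᗮ, ∫⁻ x : V, F (x + y) := by
  have hp := (V.measurePreserving_measurableEquivProd (0 : E)).symm
  rw [InnerProductSpace.euclideanHausdorffMeasure_eq_volume] at hp
  rw [← hp.lintegral_comp hF, Measure.volume_eq_prod, lintegral_prod_symm']
  · simp
  · exact hF.comp (MeasurableEquiv.measurable _)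

theorem lintegral_comp_linearMap_of_normDet_ne_zero {U W : Type*} [NormedAddCommGroup U]
    [InnerProductSpace ℝ U] [FiniteDimensional ℝ U] [MeasurableSpace U] [BorelSpace U]
    [NormedAddCommGroup W] [InnerProductSpace ℝ W] [FiniteDimensional ℝ W] [MeasurableSpace W]
    [BorelSpace W] (B : U →ₗ[ℝ] W) (hB : B.normDet ≠ 0) (h : finrank ℝ U = finrank ℝ W)
    {F : W → ℝ≥0∞} (hF : Measurable F) :
    ∫⁻ x, F (B x) = (ENNReal.ofReal B.normDet)⁻¹ * ∫⁻ y, F y := by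
  have hBc : Continuous B := B.continuous_of_finiteDimensional
  have hinj : Function.Injective B := by
    rw [Ne, LinearMap.normDet_eq_zero_iff_ker_ne_bot, not_not] at hB
    exact LinearMap.ker_eq_bot.1 hB
  have hsurj : Function.Surjective B :=
    (LinearMap.injective_iff_surjective_of_finrank_eq_finrank h).1 hinj
  have hpos : 0 < B.normDet := lt_of_le_of_ne B.normDet_nonneg (Ne.symm hB)
  have hmap : Measure.map B (volume : Measure U) =
      (ENNReal.ofReal B.normDet)⁻¹ • (volume : Measure W) := by
    ext s hs
    rw [Measure.map_apply hBc.measurable hs, Measure.smul_apply, smul_eq_mul]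
    have h1 := B.euclideanHausdorffMeasure_image_eq_normDet_mul_volume (B ⁻¹' s)
    rw [image_preimage_eq _ hsurj, h, InnerProductSpace.euclideanHausdorffMeasure_eq_volume] at h1
    rw [h1, ← mul_assoc, ENNReal.inv_mul_cancel (by simpa using hpos) ENNReal.ofReal_ne_top,
      one_mul]
  rw [← lintegral_map hF hBc.measurable, hmap, lintegral_smul_measure, smul_eq_mul]

end Slicing
end KPlane

/-! ### Local distortion of Hausdorff measure by immersions, and local comparison of measures -/

namespace KPlane
section BiLipschitz
open Module Filter Asymptotics

/-- If `f` distorts distances at most `c` times as much as `g`, then images under `f` are images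
under a `c`-Lipschitz map of images under `g`. -/
theorem euclideanHausdorffMeasure_image_le_of_edist_le {α X Y : Type*} [EMetricSpace X]
    [MeasurableSpace X] [BorelSpace X] [EMetricSpace Y] [MeasurableSpace Y] [BorelSpace Y]
    {f : α → X} {g : α → Y} {C : Set α} {c : ℝ≥0}
    (h : ∀ a ∈ C, ∀ b ∈ C, edist (f a) (f b) ≤ c * edist (g a) (g b)) (d : ℕ) :
    μHE[d] (f '' C) ≤ c ^ d * μHE[d] (g '' C) := by
  rcases C.eq_empty_or_nonempty with rfl | ⟨a₀, -⟩
  · simp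
  have : Nonempty α := ⟨a₀⟩
  have hinv : ∀ a ∈ C, f (Function.invFunOn g C (g a)) = f a := fun a ha => by
    have h1 := Function.invFunOn_mem (mem_image_of_mem g ha)
    have h2 := Function.invFunOn_eq (mem_image_of_mem g ha)
    have h3 := h _ h1 a ha
    rw [h2, edist_self, mul_zero] at h3
    exact edist_le_zero.1 h3
  have hlip : LipschitzOnWith c (f ∘ Function.invFunOn g C) (g '' C) := by
    rintro _ ⟨a, ha, rfl⟩ _ ⟨b, hb, rfl⟩
    simp only [Function.comp_apply, hinv a ha, hinv b hb]
    exact h a ha b hb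
  have himg : f '' C = (f ∘ Function.invFunOn g C) '' (g '' C) := by
    rw [image_image]
    exact image_congr fun a ha => (hinv a ha).symm
  have key := hlip.hausdorffMeasure_image_le (d := d) d.cast_nonneg
  rw [← himg, ENNReal.rpow_natCast] at key
  simp_rw [Measure.euclideanHausdorffMeasure_def, Measure.smul_apply, ENNReal.smul_def, smul_eq_mul]
  rw [mul_left_comm]
  gcongr

variable {U F : Type*} [NormedAddCommGroup U] [NormedSpace ℝ U] [FiniteDimensional ℝ U]
  [NormedAddCommGroup F] [NormedSpace ℝ F]

/-- Near a point where it is strictly differentiable with injective derivative `L`, a map distorts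
distances by the same factors as `L`, up to a constant as close to `1` as desired. -/
theorem eventually_edist_le_of_hasStrictFDerivAt {φ : U → F} {L : U →L[ℝ] F} {x : U}
    (hφ : HasStrictFDerivAt φ L x) (hL : Function.Injective L) {c : ℝ≥0} (hc : 1 < c) :
    ∃ O ∈ 𝓝 x, ∀ a ∈ O, ∀ b ∈ O, edist (φ a) (φ b) ≤ c * edist (L a) (L b) ∧
      edist (L a) (L b) ≤ c * edist (φ a) (φ b) := by
  obtain ⟨K, hK, hKL⟩ := L.toLinearMap.exists_antilipschitzWith (LinearMap.ker_eq_bot.2 hL)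
  have hc0 : (1 : ℝ) < c := by exact_mod_cast hc
  -- The relative error `δ` satisfies `1 + δ ≤ c` and `c * (1 - δ) = 1`.
  set δ : ℝ := 1 - (c : ℝ)⁻¹ with hδ
  have hcc : (c : ℝ) * (c : ℝ)⁻¹ = 1 := mul_inv_cancel₀ (by positivity)
  have hδ0 : 0 < δ := by
    have : (c : ℝ)⁻¹ < 1 := inv_lt_one_of_one_lt₀ hc0
    linarith
  have hδ1 : 1 + δ ≤ c := by
    have := sq_nonneg ((c : ℝ) - 1)
    nlinarith [inv_pos.2 (zero_lt_one.trans hc0)]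
  have hδ2 : c * (1 - δ) = 1 := by rw [hδ]; linarith
  have hK' : (0 : ℝ) < K := by exact_mod_cast hK
  have h1 := hφ.isLittleO.def (c := δ / K) (by positivity)
  rw [nhds_prod_eq] at h1
  obtain ⟨O, hO, h2⟩ := mem_prod_self_iff.1 h1
  refine ⟨O, hO, fun a ha b hb => ?_⟩
  have h3 : ‖φ a - φ b - L (a - b)‖ ≤ δ / K * ‖a - b‖ := h2 (mk_mem_prod ha hb)
  have h4 : ‖a - b‖ ≤ K * ‖L a - L b‖ := by
    simpa [dist_eq_norm] using hKL.le_mul_dist a b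
  have h5 : ‖φ a - φ b - (L a - L b)‖ ≤ δ * ‖L a - L b‖ := by
    rw [← map_sub]
    refine h3.trans ?_
    rw [map_sub]
    calc δ / K * ‖a - b‖ ≤ δ / K * (K * ‖L a - L b‖) := by gcongr
      _ = δ * ‖L a - L b‖ := by field_simp
  have h6 : ‖φ a - φ b‖ ≤ ‖L a - L b‖ + δ * ‖L a - L b‖ := by
    have := norm_add_le (L a - L b) (φ a - φ b - (L a - L b))
    rw [add_sub_cancel] at this
    linarith
  have h7 : ‖L a - L b‖ - δ * ‖L a - L b‖ ≤ ‖φ a - φ b‖ := by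
    have := norm_sub_norm_le (L a - L b) (L a - L b - (φ a - φ b))
    rw [sub_sub_cancel, norm_sub_rev (L a - L b)] at this
    linarith
  simp only [edist_dist, dist_eq_norm]
  rw [← ENNReal.ofReal_coe_nnreal (p := c), ← ENNReal.ofReal_mul c.coe_nonneg,
    ← ENNReal.ofReal_mul c.coe_nonneg]
  constructor <;> apply ENNReal.ofReal_le_ofReal
  · nlinarith [norm_nonneg (L a - L b)]
  · have : ‖L a - L b‖ = c * (‖L a - L b‖ - δ * ‖L a - L b‖) := by
      calc ‖L a - L b‖ = (c * (1 - δ)) * ‖L a - L b‖ := by rw [hδ2, one_mul]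
        _ = _ := by ring
    rw [this]
    gcongr

end BiLipschitz

section LocalVolume
open Module Filter

variable {U F : Type*} [NormedAddCommGroup U] [InnerProductSpace ℝ U] [FiniteDimensional ℝ U]
  [MeasurableSpace U] [BorelSpace U] [NormedAddCommGroup F] [InnerProductSpace ℝ F]
  [MeasurableSpace F] [BorelSpace F]

/-- Infinitesimal area formula: near `x`, the map `φ` multiplies `k`-dimensional volumes by the
factor `normDet (Dφ(x))`, up to a constant as close to `1` as desired. -/
theorem eventually_euclideanHausdorffMeasure_image_le {k : ℕ} (hk : finrank ℝ U = k) {φ : U → F}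
    {L : U →L[ℝ] F} {x : U} (hφ : HasStrictFDerivAt φ L x) (hL : Function.Injective L) {c : ℝ≥0}
    (hc : 1 < c) : ∃ O ∈ 𝓝 x, ∀ C ⊆ O,
      μHE[k] (φ '' C) ≤ c ^ k * (ENNReal.ofReal L.toLinearMap.normDet * volume C) ∧
      ENNReal.ofReal L.toLinearMap.normDet * volume C ≤ c ^ k * μHE[k] (φ '' C) := by
  subst hk
  obtain ⟨O, hO, h⟩ := eventually_edist_le_of_hasStrictFDerivAt hφ hL hc
  refine ⟨O, hO, fun C hC => ?_⟩
  rw [← L.toLinearMap.euclideanHausdorffMeasure_image_eq_normDet_mul_volume C]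
  exact ⟨euclideanHausdorffMeasure_image_le_of_edist_le
      (fun a ha b hb => (h a (hC ha) b (hC hb)).1) _,
    euclideanHausdorffMeasure_image_le_of_edist_le
      (fun a ha b hb => (h a (hC ha) b (hC hb)).2) _⟩

end LocalVolume

section CompareMeasures
open Filter

/-- If `ν ≤ c ^ m • μ` locally for every `c > 1`, then `ν ≤ μ`. -/
theorem measure_le_of_forall_nhds {X : Type*} [TopologicalSpace X] [SecondCountableTopology X]
    [MeasurableSpace X] [OpensMeasurableSpace X] {μ ν : Measure X} (m : ℕ)
    (h : ∀ c : ℝ≥0, 1 < c → ∀ x, ∃ N ∈ 𝓝 x, ∀ B ⊆ N, MeasurableSet B → ν B ≤ c ^ m * μ B) :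
    ν ≤ μ := by
  refine Measure.le_iff.2 fun B hB => ?_
  have step : ∀ c : ℝ≥0, 1 < c → ν B ≤ c ^ m * μ B := by
    intro c hc
    choose N hN hNB using h c hc
    obtain ⟨s, hs, hcover⟩ := TopologicalSpace.countable_cover_nhds
      (f := fun x => interior (N x)) fun x => interior_mem_nhds.2 (hN x)
    rcases isEmpty_or_nonempty X with hX | hX
    · simp [Set.eq_empty_of_isEmpty B]
    have hsne : s.Nonempty := by
      by_contra hne
      rw [not_nonempty_iff_eq_empty] at hne
      simp only [hne, mem_empty_iff_false, iUnion_of_empty, iUnion_empty] at hcover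
      exact empty_ne_univ hcover
    obtain ⟨e, rfl⟩ := hs.exists_eq_range hsne
    set D := disjointed fun i => interior (N (e i))
    have hD : ∀ i, MeasurableSet (D i) :=
      MeasurableSet.disjointed fun i => isOpen_interior.measurableSet
    have hDu : ⋃ i, D i = univ := by
      rw [iUnion_disjointed, ← hcover, biUnion_range]
    have hBD : B = ⋃ i, B ∩ D i := by rw [← inter_iUnion, hDu, inter_univ]
    have hdisj : Pairwise (Function.onFun Disjoint fun i => B ∩ D i) := fun i j hij =>
      (disjoint_disjointed _ hij).mono inter_subset_right inter_subset_right
    rw [hBD, measure_iUnion hdisj fun i => hB.inter (hD i),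
      measure_iUnion hdisj fun i => hB.inter (hD i), ← ENNReal.tsum_mul_left]
    refine ENNReal.tsum_le_tsum fun i => hNB (e i) _ ?_ (hB.inter (hD i))
    exact inter_subset_right.trans ((disjointed_subset _ i).trans interior_subset)
  have hlim : Tendsto (fun c : ℝ≥0 => (c : ℝ≥0∞) ^ m * μ B) (𝓝[>] 1) (𝓝 (1 ^ m * μ B)) := by
    refine ENNReal.Tendsto.mul_const ?_ (Or.inl (by simp))
    exact ((ENNReal.continuous_pow m).comp ENNReal.continuous_coe).tendsto' _ _ (by simp)
      |>.mono_left nhdsWithin_le_nhds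
  rw [one_pow, one_mul] at hlim
  exact ge_of_tendsto hlim (eventually_nhdsWithin_of_forall step)

end CompareMeasures
end KPlane

/-! ### Charts and tangent spaces -/

namespace KPlane
section Charts
open Module Filter Asymptotics

variable {k n : ℕ} {S : Set (Eucl n)} {U : Set (Eucl k)} {ψ : Eucl k → Eucl n}

theorem IsLocalParam.mapsTo (h : IsLocalParam S U ψ) : MapsTo ψ U S := by
  obtain ⟨W, -, hW⟩ := h.image_open U Subset.rfl h.isOpen
  exact mapsTo_iff_image_subset.2 (hW ▸ inter_subset_left)

theorem IsLocalParam.hasStrictFDerivAt (h : IsLocalParam S U ψ) {x : Eucl k} (hx : x ∈ U) :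
    HasStrictFDerivAt ψ (fderiv ℝ ψ x) x :=
  (h.contDiffOn.contDiffAt (h.isOpen.mem_nhds hx)).hasStrictFDerivAt one_ne_zero

/-- A parametrisation is a homeomorphism from `U` onto an open subset of the subtype `S`. -/
theorem IsLocalParam.isOpenEmbedding (h : IsLocalParam S U ψ) :
    IsOpenEmbedding (h.mapsTo.restrict ψ U S) := by
  refine .of_continuous_injective_isOpenMap (h.contDiffOn.continuousOn.mapsToRestrict h.mapsTo)
    ((injOn_iff_injective.1 h.injOn).codRestrict fun x => h.mapsTo x.2) ?_
  intro O hO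
  obtain ⟨O', hO', rfl⟩ := isOpen_induced_iff.1 hO
  obtain ⟨W, hW, hWe⟩ := h.image_open (O' ∩ U) inter_subset_right (hO'.inter h.isOpen)
  refine isOpen_induced_iff.2 ⟨W, hW, ?_⟩
  ext ξ
  constructor
  · intro hξ
    have : (ξ : Eucl n) ∈ ψ '' (O' ∩ U) := hWe ▸ ⟨ξ.2, hξ⟩
    obtain ⟨a, ⟨ha, haU⟩, hae⟩ := this
    exact ⟨⟨a, haU⟩, ha, Subtype.ext hae⟩
  · rintro ⟨a, ha, rfl⟩
    have : ψ a ∈ ψ '' (O' ∩ U) := ⟨a, ⟨ha, a.2⟩, rfl⟩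
    rw [hWe] at this
    exact this.2

theorem IsC1Submanifold.measurableSet (hS : IsC1Submanifold k S) : MeasurableSet S := by
  choose! U ψ hψ hmem using hS
  have hnhds : ∀ ξ ∈ S, ψ ξ '' U ξ ∈ 𝓝[S] ξ := fun ξ hξ => by
    obtain ⟨W, hW, hWe⟩ := (hψ ξ hξ).image_open _ Subset.rfl (hψ ξ hξ).isOpen
    rw [hWe]
    exact inter_mem_nhdsWithin _ (hW.mem_nhds (hWe ▸ hmem ξ hξ).2)
  obtain ⟨t, htS, ht, hcover⟩ := TopologicalSpace.countable_cover_nhdsWithin hnhds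
  have : S = ⋃ ξ ∈ t, ψ ξ '' U ξ :=
    hcover.antisymm (iUnion₂_subset fun ξ hξ => (hψ ξ (htS hξ)).mapsTo.image_subset)
  rw [this]
  exact MeasurableSet.biUnion ht fun ξ hξ => (hψ ξ (htS hξ)).isOpen.measurableSet
    |>.image_of_continuousOn_injOn (hψ ξ (htS hξ)).contDiffOn.continuousOn (hψ ξ (htS hξ)).injOn

/-- A vector `Dψ(x) a` is the velocity of `t ↦ ψ (x + t a)`, a curve that only exists for small `t`;
elsewhere it is replaced by the constant `ψ x`. -/
theorem IsLocalParam.range_fderiv_le_tangentSpace (h : IsLocalParam S U ψ) {x : Eucl k}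
    (hx : x ∈ U) : (fderiv ℝ ψ x).range ≤ tangentSpace S (ψ x) := by
  classical
  rintro _ ⟨a, rfl⟩
  refine Submodule.subset_span ⟨fun t => if x + t • a ∈ U then ψ (x + t • a) else ψ x, ?_, ?_, ?_⟩
  · intro t
    dsimp only
    split_ifs with ht
    exacts [h.mapsTo ht, h.mapsTo hx]
  · simp
  · have hline : HasDerivAt (fun t : ℝ => x + t • a) a 0 := by
      simpa using ((hasDerivAt_id (0 : ℝ)).smul_const a).const_add x
    have hcomp : HasDerivAt (fun t : ℝ => ψ (x + t • a)) (fderiv ℝ ψ x a) 0 := by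
      refine HasFDerivAt.comp_hasDerivAt (0 : ℝ) ?_ hline
      simpa using (h.hasStrictFDerivAt hx).hasFDerivAt
    refine hcomp.congr_of_eventuallyEq ?_
    have : ∀ᶠ t : ℝ in 𝓝 0, x + t • a ∈ U :=
      hline.continuousAt.eventually_mem (by simpa using h.isOpen.mem_nhds hx)
    filter_upwards [this] with t ht
    rw [if_pos ht]

theorem IsLocalParam.tangentSpace_le_range_fderiv (h : IsLocalParam S U ψ) {x : Eucl k}
    (hx : x ∈ U) : tangentSpace S (ψ x) ≤ (fderiv ℝ ψ x).range := by
  refine Submodule.span_le.2 ?_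
  rintro v ⟨γ, hγS, hγ0, hγ⟩
  have hφ := h.hasStrictFDerivAt hx
  set L := fderiv ℝ ψ x with hLdef
  have hL : Function.Injective L := h.immersion x hx
  obtain ⟨K, -, hKL⟩ := L.toLinearMap.exists_antilipschitzWith (LinearMap.ker_eq_bot.2 hL)
  obtain ⟨O, hO, hbd⟩ := eventually_edist_le_of_hasStrictFDerivAt hφ hL one_lt_two
  -- The coordinates `a t` of `γ t` in the chart `ψ`.
  obtain ⟨W, hW, hWe⟩ := h.image_open (interior O ∩ U) inter_subset_right
    (isOpen_interior.inter h.isOpen)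
  have hγW : ∀ᶠ t in 𝓝 (0 : ℝ), γ t ∈ W := by
    refine hγ.continuousAt.eventually_mem (hW.mem_nhds ?_)
    have : ψ x ∈ ψ '' (interior O ∩ U) := ⟨x, ⟨mem_interior_iff_mem_nhds.2 hO, hx⟩, rfl⟩
    rw [hγ0]
    exact (hWe ▸ this).2
  have hex : ∀ t, ∃ a, γ t ∈ W → a ∈ O ∧ ψ a = γ t := fun t => by
    by_cases ht : γ t ∈ W
    · have : γ t ∈ ψ '' (interior O ∩ U) := hWe ▸ ⟨hγS t, ht⟩
      obtain ⟨a, ha, hae⟩ := this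
      exact ⟨a, fun _ => ⟨interior_subset ha.1, hae⟩⟩
    · exact ⟨0, fun h => absurd h ht⟩
  choose a ha using hex
  have hγO : (fun t => γ t - ψ x) =O[𝓝 0] fun t : ℝ => t := by
    simpa [hγ0] using hγ.isBigO_sub
  have haO : (fun t => a t - x) =O[𝓝 0] fun t : ℝ => t := by
    refine IsBigO.trans (IsBigO.of_bound (K * 2) ?_) hγO
    filter_upwards [hγW] with t ht
    have h1 := (hbd _ (ha t ht).1 x (mem_of_mem_nhds hO)).2
    rw [(ha t ht).2] at h1
    have h2 := hKL (a t) x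
    have h3 : edist (a t) x ≤ K * (2 * edist (γ t) (ψ x)) := h2.trans (by gcongr; exact h1)
    have h4 : dist (a t) x ≤ K * (2 * dist (γ t) (ψ x)) := by
      have := ENNReal.toReal_mono (by finiteness) h3
      simpa [edist_dist, ENNReal.toReal_ofReal dist_nonneg] using this
    rw [← dist_eq_norm, ← dist_eq_norm]
    linarith
  have ha_tendsto : Tendsto a (𝓝 0) (𝓝 x) := by
    rw [tendsto_iff_norm_sub_tendsto_zero]
    exact (haO.trans_tendsto tendsto_id).norm.trans (by simp)
  have h1 : (fun t => γ t - ψ x - L (a t - x)) =o[𝓝 0] fun t : ℝ => t := by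
    refine IsLittleO.congr' ((hφ.hasFDerivAt.isLittleO.comp_tendsto ha_tendsto).trans_isBigO haO)
      ?_ EventuallyEq.rfl
    filter_upwards [hγW] with t ht
    simp [(ha t ht).2]
  have h2 : (fun t => γ t - ψ x - t • v) =o[𝓝 0] fun t : ℝ => t := by
    simpa [hγ0] using hasDerivAt_iff_isLittleO.1 hγ
  -- The component of `v` orthogonal to the range of `L` is `o(1)`, hence vanishes.
  have h3 : (fun t : ℝ => t • L.rangeᗮ.starProjection v) =o[𝓝 0] fun t : ℝ => t := by
    have h4 := (L.rangeᗮ.starProjection.isBigO_comp _ _).trans_isLittleO (h1.sub h2)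
    refine h4.congr_left fun t => ?_
    have h5 : L.rangeᗮ.starProjection (L (a t - x)) = 0 := by
      rw [Submodule.starProjection_apply_eq_zero_iff, Submodule.orthogonal_orthogonal]
      exact ⟨_, rfl⟩
    rw [sub_sub_sub_cancel_left, map_sub, h5, sub_zero, map_smul]
  have h6 : L.rangeᗮ.starProjection v = 0 := by
    have h7 : HasDerivAt (fun t : ℝ => t • L.rangeᗮ.starProjection v) 0 0 := by
      rw [hasDerivAt_iff_isLittleO]; simpa using h3
    have h8 : HasDerivAt (fun t : ℝ => t • L.rangeᗮ.starProjection v)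
        (L.rangeᗮ.starProjection v) 0 := by
      simpa using (hasDerivAt_id (0 : ℝ)).smul_const (L.rangeᗮ.starProjection v)
    exact h8.unique h7
  rwa [Submodule.starProjection_apply_eq_zero_iff, Submodule.orthogonal_orthogonal] at h6

theorem IsLocalParam.tangentSpace_eq (h : IsLocalParam S U ψ) {x : Eucl k} (hx : x ∈ U) :
    tangentSpace S (ψ x) = (fderiv ℝ ψ x).range :=
  (h.tangentSpace_le_range_fderiv hx).antisymm (h.range_fderiv_le_tangentSpace hx)

theorem IsC1Submanifold.finrank_tangentSpace (hS : IsC1Submanifold k S) {ξ : Eucl n} (hξ : ξ ∈ S) :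
    finrank ℝ (tangentSpace S ξ) = k := by
  obtain ⟨U, ψ, hψ, x, hx, rfl⟩ := hS ξ hξ
  rw [hψ.tangentSpace_eq hx]
  exact (LinearMap.finrank_range_of_inj (hψ.immersion x hx)).trans (by simp)

end Charts
end KPlane

/-! ### The area formula for projections of a submanifold -/

noncomputable section

namespace KPlane
section Jacobian
open Module Filter

variable {k n : ℕ} {S : Set (Eucl n)} {U : Set (Eucl k)} {ψ : Eucl k → Eucl n}

theorem continuous_normDet {E F : Type*} [NormedAddCommGroup E] [InnerProductSpace ℝ E]
    [FiniteDimensional ℝ E] [NormedAddCommGroup F] [InnerProductSpace ℝ F] [CompleteSpace F] :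
    Continuous fun L : E →L[ℝ] F => L.toLinearMap.normDet := by
  have : CompleteSpace E := FiniteDimensional.complete ℝ E
  have h : (fun L : E →L[ℝ] F => L.toLinearMap.normDet) =
      fun L : E →L[ℝ] F => √((ContinuousLinearMap.adjoint L ∘L L).det) := by
    funext L
    have h1 := L.normDet_sq
    simp only [RCLike.ofReal_real_eq_id, id_eq] at h1
    rw [← h1, Real.sqrt_sq (LinearMap.normDet_nonneg _)]
  rw [h]
  exact Real.continuous_sqrt.comp (ContinuousLinearMap.continuous_det.comp
    ((ContinuousLinearMap.adjoint (𝕜 := ℝ) (E := E) (F := F)).continuous.clm_comp continuous_id))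

theorem normDet_pos_of_injective {E F : Type*} [NormedAddCommGroup E] [InnerProductSpace ℝ E]
    [FiniteDimensional ℝ E] [NormedAddCommGroup F] [InnerProductSpace ℝ F] {L : E →ₗ[ℝ] F}
    (hL : Function.Injective L) : 0 < L.normDet := by
  refine lt_of_le_of_ne L.normDet_nonneg (Ne.symm ?_)
  rw [Ne, LinearMap.normDet_eq_zero_iff_ker_ne_bot, not_not]
  exact LinearMap.ker_eq_bot.2 hL

theorem IsLocalParam.normDet_comp_fderiv (h : IsLocalParam S U ψ) {x : Eucl k} (hx : x ∈ U)
    (A : Eucl n →L[ℝ] Eucl n) :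
    (A ∘L fderiv ℝ ψ x).toLinearMap.normDet =
      (A.toLinearMap.domRestrict (tangentSpace S (ψ x))).normDet *
        (fderiv ℝ ψ x).toLinearMap.normDet := by
  rw [h.tangentSpace_eq hx]
  exact LinearMap.normDet_comp _ _

/-- The volume distortion of a linear map `A` on `T_ξ S` depends continuously on `A` and `ξ`. -/
theorem IsC1Submanifold.continuous_normDet_domRestrict (hS : IsC1Submanifold k S) :
    Continuous fun p : (Eucl n →L[ℝ] Eucl n) × S =>
      (p.1.toLinearMap.domRestrict (tangentSpace S p.2)).normDet := by
  rw [continuous_iff_continuousAt]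
  rintro ⟨A, ξ, hξ⟩
  obtain ⟨U, ψ, hψ, x, hx, rfl⟩ := hS ξ hξ
  have he := (IsOpenEmbedding.id (X := Eucl n →L[ℝ] Eucl n)).prodMap hψ.isOpenEmbedding
  have hpt : ((A, ⟨ψ x, hξ⟩) : (Eucl n →L[ℝ] Eucl n) × S) =
    Prod.map id (hψ.mapsTo.restrict ψ U S) (A, ⟨x, hx⟩) := rfl
  rw [hpt, ← he.continuousAt_iff]
  refine Continuous.continuousAt ?_
  have hcomp : ((fun p : (Eucl n →L[ℝ] Eucl n) × S =>
      (p.1.toLinearMap.domRestrict (tangentSpace S p.2)).normDet) ∘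
      Prod.map id (hψ.mapsTo.restrict ψ U S)) = fun p : (Eucl n →L[ℝ] Eucl n) × U =>
        (p.1 ∘L fderiv ℝ ψ p.2).toLinearMap.normDet /
          (fderiv ℝ ψ p.2).toLinearMap.normDet := by
    funext p
    rw [hψ.normDet_comp_fderiv p.2.2, mul_div_cancel_right₀ _
      (normDet_pos_of_injective (hψ.immersion _ p.2.2)).ne']
    rfl
  rw [hcomp]
  have hfd : Continuous fun p : (Eucl n →L[ℝ] Eucl n) × U => fderiv ℝ ψ p.2 :=
    (hψ.contDiffOn.continuousOn_fderiv_of_isOpen hψ.isOpen le_rfl).domRestrict.comp continuous_snd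
  exact (continuous_normDet.comp (continuous_fst.clm_comp hfd)).div
    (continuous_normDet.comp hfd)
    fun p => (normDet_pos_of_injective (hψ.immersion _ p.2.2)).ne'

/-- The surface measure, as a measure on the subtype `S`. Measures on the subtype allow the
projections of `S` to be treated as measurable embeddings. -/
def intrinsicMeasure {n : ℕ} (k : ℕ) (S : Set (Eucl n)) : Measure S :=
  (μHE[k] : Measure (Eucl n)).comap Subtype.val

theorem IsC1Submanifold.intrinsicMeasure_apply (hS : IsC1Submanifold k S) (B : Set S) :
    intrinsicMeasure k S B = μHE[k] (Subtype.val '' B) :=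
  (MeasurableEmbedding.subtype_coe hS.measurableSet).comap_apply _ _

theorem IsLocalParam.isLocallyFiniteAt (h : IsLocalParam S U ψ) (hS : IsC1Submanifold k S)
    {x : Eucl k} (hx : x ∈ U) :
    (intrinsicMeasure k S).FiniteAtFilter (𝓝 ⟨ψ x, h.mapsTo hx⟩) := by
  obtain ⟨O, hO, hvol⟩ := eventually_euclideanHausdorffMeasure_image_le (finrank_euclideanSpace_fin)
    (h.hasStrictFDerivAt hx) (h.immersion x hx) one_lt_two
  have hOU : (Subtype.val ⁻¹' (O ∩ Metric.ball x 1) : Set U) ∈ 𝓝 (⟨x, hx⟩ : U) :=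
    continuous_subtype_val.continuousAt.preimage_mem_nhds
      (inter_mem hO (Metric.ball_mem_nhds x one_pos))
  refine ⟨h.mapsTo.restrict ψ U S '' _, h.isOpenEmbedding.isOpenMap.image_mem_nhds hOU, ?_⟩
  have himg : Subtype.val '' (h.mapsTo.restrict ψ U S '' (Subtype.val ⁻¹' (O ∩ Metric.ball x 1))) =
      ψ '' (U ∩ (O ∩ Metric.ball x 1)) := by
    rw [← Subtype.image_preimage_coe U, image_image, image_image]
    rfl
  rw [hS.intrinsicMeasure_apply, himg]
  refine ((hvol _ (inter_subset_right.trans inter_subset_left)).1).trans_lt ?_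
  have : volume (U ∩ (O ∩ Metric.ball x 1)) < ⊤ :=
    (measure_mono (inter_subset_right.trans inter_subset_right)).trans_lt measure_ball_lt_top
  finiteness

theorem IsC1Submanifold.isLocallyFiniteMeasure (hS : IsC1Submanifold k S) :
    IsLocallyFiniteMeasure (intrinsicMeasure k S) := by
  refine ⟨fun ⟨ξ, hξ⟩ => ?_⟩
  obtain ⟨U, ψ, hψ, x, hx, rfl⟩ := hS ξ hξ
  exact hψ.isLocallyFiniteAt hS hx

/-- The orthogonal projection of `S` to a subspace `V`, as a map between subtypes. -/
def projTo (S : Set (Eucl n)) (V : Submodule ℝ (Eucl n)) (ξ : S) : V :=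
  V.orthogonalProjectionOnto (ξ : Eucl n)

theorem continuous_projTo (V : Submodule ℝ (Eucl n)) : Continuous (projTo S V) :=
  V.orthogonalProjectionOnto.continuous.comp continuous_subtype_val

theorem TransverseGlobal.injective_projTo {V : Submodule ℝ (Eucl n)} (hV : TransverseGlobal S V) :
    Function.Injective (projTo S V) := by
  intro ξ η h
  have h1 : (ξ - η : Eucl n) ∈ Submodule.span ℝ {(ξ - η : Eucl n)} ⊓ Vᗮ := by
    refine ⟨Submodule.mem_span_singleton_self _, ?_⟩
    rw [SetLike.mem_coe, ← Submodule.orthogonalProjectionOnto_eq_zero_iff, map_sub,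
      sub_eq_zero]
    exact h
  rw [hV ξ ξ.2 η η.2] at h1
  exact Subtype.ext (sub_eq_zero.1 h1)

theorem TransverseGlobal.measurableEmbedding_projTo (hS : IsC1Submanifold k S)
    {V : Submodule ℝ (Eucl n)} (hV : TransverseGlobal S V) :
    MeasurableEmbedding (projTo S V) :=
  have := hS.measurableSet.standardBorel
  (continuous_projTo V).measurable.measurableEmbedding hV.injective_projTo

/-- The factor by which the orthogonal projection `T → V` between two subspaces changes volumes;
it vanishes if the projection is not injective on `T`. -/
def projJacobian (V T : Submodule ℝ (Eucl n)) : ℝ≥0∞ :=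
  ENNReal.ofReal (V.starProjection.toLinearMap.domRestrict T).normDet

theorem projJacobian_ne_top (V T : Submodule ℝ (Eucl n)) : projJacobian V T ≠ ⊤ :=
  ENNReal.ofReal_ne_top

theorem projJacobian_ne_zero {V T : Submodule ℝ (Eucl n)} (h : T ⊓ Vᗮ = ⊥) :
    projJacobian V T ≠ 0 := by
  rw [projJacobian, Ne, ENNReal.ofReal_eq_zero, not_le]
  exact lt_of_le_of_ne (LinearMap.normDet_nonneg _) (normDet_domRestrict_ne_zero h).symm

theorem IsC1Submanifold.continuous_projJacobian (hS : IsC1Submanifold k S)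
    (V : Submodule ℝ (Eucl n)) : Continuous fun ξ : S => projJacobian V (tangentSpace S ξ) :=
  have h1 : Continuous fun ξ : S => ((V.starProjection : Eucl n →L[ℝ] Eucl n), ξ) :=
    Continuous.prodMk_right _
  have h2 := hS.continuous_normDet_domRestrict.comp h1
  ENNReal.continuous_ofReal.comp h2

/-- Near a point of `S`, the ratio of Lebesgue measure of the projection to `V` and of surface
measure is the Jacobian of the projection, up to a constant as close to `1` as desired. -/
theorem exists_nhds_comap_projTo_le (hS : IsC1Submanifold k S) {V : Submodule ℝ (Eucl n)}
    (hVk : finrank ℝ V = k) (hT : TransverseLocal S V) (hG : TransverseGlobal S V) {c : ℝ≥0}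
    (hc : 1 < c) (ξ : S) : ∃ N ∈ 𝓝 ξ, ∀ B ⊆ N, MeasurableSet B →
      (volume : Measure V).comap (projTo S V) B ≤ c ^ (2 * k + 1) *
        (intrinsicMeasure k S).withDensity (fun ξ => projJacobian V (tangentSpace S ξ)) B ∧
      (intrinsicMeasure k S).withDensity (fun ξ => projJacobian V (tangentSpace S ξ)) B ≤
        c ^ (2 * k + 1) * (volume : Measure V).comap (projTo S V) B := by
  obtain ⟨ξ, hξ⟩ := ξ
  obtain ⟨U, ψ, hψ, x, hx, rfl⟩ := hS ξ hξ
  set L := fderiv ℝ ψ x with hL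
  set P : Eucl n →L[ℝ] V := V.orthogonalProjectionOnto with hP
  set J := projJacobian V (tangentSpace S (ψ x)) with hJ
  have hJ0 : J ≠ 0 := projJacobian_ne_zero (hT _ hξ)
  have hnd : ENNReal.ofReal (P ∘L L).toLinearMap.normDet =
      J * ENNReal.ofReal L.toLinearMap.normDet := by
    rw [hJ, projJacobian, ← ENNReal.ofReal_mul (LinearMap.normDet_nonneg _),
      ← hψ.normDet_comp_fderiv hx]
    congr 1
    exact LinearMap.normDet_codRestrict (p := V)
      (f := (V.starProjection ∘L fderiv ℝ ψ x).toLinearMap) fun y => V.starProjection_apply_mem _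
  -- Both `ψ` and its projection to `V` are immersions at `x`, so volumes of small sets and of their
  -- projections are both comparable with Lebesgue measure in the chart.
  have hPL : Function.Injective (P ∘L L) := by
    have h1 : (P ∘L L).toLinearMap.normDet ≠ 0 := fun h0 => by
      rw [h0, ENNReal.ofReal_zero] at hnd
      refine mul_ne_zero hJ0 ?_ hnd.symm
      exact (ENNReal.ofReal_pos.2 (normDet_pos_of_injective (hψ.immersion x hx))).ne'
    rw [Ne, LinearMap.normDet_eq_zero_iff_ker_ne_bot, not_not] at h1
    exact LinearMap.ker_eq_bot.1 h1
  have hPψ : HasStrictFDerivAt (fun y => P (ψ y)) (P ∘L L) x :=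
    P.hasStrictFDerivAt.comp x (hψ.hasStrictFDerivAt hx)
  obtain ⟨O₁, hO₁, h₁⟩ := eventually_euclideanHausdorffMeasure_image_le finrank_euclideanSpace_fin
    (hψ.hasStrictFDerivAt hx) (hψ.immersion x hx) hc
  obtain ⟨O₂, hO₂, h₂⟩ := eventually_euclideanHausdorffMeasure_image_le finrank_euclideanSpace_fin
    hPψ hPL hc
  have hJtop : J ≠ ⊤ := projJacobian_ne_top _ _
  have hc' : (1 : ℝ≥0∞) < c := by exact_mod_cast hc
  have hcJ : J < c * J := by
    simpa using (ENNReal.mul_lt_mul_iff_left hJ0 hJtop).2 hc'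
  -- On `N₀` the Jacobian differs from its value at `ψ x` by at most the factor `c`.
  have hcont := (hS.continuous_projJacobian V).continuousAt (x := ⟨ψ x, hξ⟩)
  have hN₀ : ∀ᶠ η : S in 𝓝 ⟨ψ x, hξ⟩, projJacobian V (tangentSpace S η) ≤ c * J ∧
      J ≤ c * projJacobian V (tangentSpace S η) := by
    refine (hcont.eventually_le_const hcJ).and ?_
    have h2 : Tendsto (fun η : S => c * projJacobian V (tangentSpace S η)) (𝓝 ⟨ψ x, hξ⟩)
        (𝓝 (c * J)) := ENNReal.Tendsto.const_mul hcont (Or.inr (by simp))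
    exact h2.eventually_const_le hcJ
  have hN₁ : hψ.mapsTo.restrict ψ U S '' (Subtype.val ⁻¹' (O₁ ∩ O₂)) ∈ 𝓝 (⟨ψ x, hξ⟩ : S) :=
    hψ.isOpenEmbedding.isOpenMap.image_mem_nhds (x := ⟨x, hx⟩)
      (continuous_subtype_val.continuousAt.preimage_mem_nhds (inter_mem hO₁ hO₂))
  refine ⟨_, inter_mem hN₁ hN₀, fun B hB hBm => ?_⟩
  obtain ⟨C, hCO, hBC⟩ := subset_image_iff.1 (hB.trans inter_subset_left)
  have himg : Subtype.val '' B = ψ '' (Subtype.val '' C) := by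
    rw [← hBC, image_image, image_image]
    rfl
  have hpimg : projTo S V '' B = (fun y => P (ψ y)) '' (Subtype.val '' C) := by
    rw [← hBC, image_image, image_image]
    rfl
  have hCO' : Subtype.val '' C ⊆ O₁ ∩ O₂ := image_subset_iff.2 hCO
  obtain ⟨h₁a, h₁b⟩ := h₁ _ (hCO'.trans inter_subset_left)
  obtain ⟨h₂a, h₂b⟩ := h₂ _ (hCO'.trans inter_subset_right)
  have hVol : (μHE[k] : Measure V) = volume := by
    rw [← hVk]
    exact InnerProductSpace.euclideanHausdorffMeasure_eq_volume
  have hv : (volume : Measure V).comap (projTo S V) B =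
      μHE[k] ((fun y => P (ψ y)) '' (Subtype.val '' C)) := by
    rw [(hG.measurableEmbedding_projTo hS).comap_apply, hpimg, hVol]
  rw [← himg, ← hS.intrinsicMeasure_apply] at h₁a h₁b
  rw [← hv, hnd, mul_assoc] at h₂a h₂b
  set D := ENNReal.ofReal L.toLinearMap.normDet * volume (Subtype.val '' C)
  set v := (volume : Measure V).comap (projTo S V) B
  set s := intrinsicMeasure k S B
  rw [withDensity_apply _ hBm]
  have h₃ : ∫⁻ η in B, projJacobian V (tangentSpace S η) ∂intrinsicMeasure k S ≤ c * J * s := by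
    rw [← setLIntegral_const]
    exact setLIntegral_mono measurable_const fun η hη => (hB hη).2.1
  have h₄ : J * s ≤ c * ∫⁻ η in B, projJacobian V (tangentSpace S η) ∂intrinsicMeasure k S := by
    rw [← setLIntegral_const, ← lintegral_const_mul' _ _ ENNReal.coe_ne_top]
    exact setLIntegral_mono ((hS.continuous_projJacobian V).measurable.const_mul _)
      fun η hη => (hB hη).2.2
  constructor
  · calc v ≤ c ^ k * (J * D) := h₂a
      _ ≤ c ^ k * (J * (c ^ k * s)) := by gcongr
      _ = c ^ k * c ^ k * (J * s) := by ring
      _ ≤ c ^ k * c ^ k *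
          (c * ∫⁻ η in B, projJacobian V (tangentSpace S η) ∂intrinsicMeasure k S) := by gcongr
      _ = _ := by ring
  · calc _ ≤ c * J * s := h₃
      _ ≤ c * J * (c ^ k * D) := by gcongr
      _ = c * c ^ k * (J * D) := by ring
      _ ≤ c * c ^ k * (c ^ k * v) := by gcongr
      _ = _ := by ring

/-- Area formula for the projection of `S` to a transverse subspace `V`: it pulls Lebesgue measure
on `V` back to the surface measure weighted by the Jacobian of the projection. -/
theorem comap_projTo_volume (hS : IsC1Submanifold k S) {V : Submodule ℝ (Eucl n)}
    (hVk : finrank ℝ V = k) (hT : TransverseLocal S V) (hG : TransverseGlobal S V) :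
    (volume : Measure V).comap (projTo S V) =
      (intrinsicMeasure k S).withDensity fun ξ => projJacobian V (tangentSpace S ξ) := by
  refine le_antisymm (measure_le_of_forall_nhds (2 * k + 1) fun c hc ξ => ?_)
    (measure_le_of_forall_nhds (2 * k + 1) fun c hc ξ => ?_)
  all_goals
    obtain ⟨N, hN, h⟩ := exists_nhds_comap_projTo_le hS hVk hT hG hc ξ
  · exact ⟨N, hN, fun B hB hBm => (h B hB hBm).1⟩
  · exact ⟨N, hN, fun B hB hBm => (h B hB hBm).2⟩

end Jacobian
end KPlane

end

/-! ### The extension operator on translates of a subspace -/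

noncomputable section

namespace KPlane
section Extension
open Module Filter
open scoped FourierTransform

variable {k n : ℕ} {S : Set (Eucl n)}

theorem lintegral_surfaceMeasure (hS : IsC1Submanifold k S) (f : Eucl n → ℝ≥0∞) :
    ∫⁻ ξ, f ξ ∂surfaceMeasure k S = ∫⁻ ξ : S, f ξ ∂intrinsicMeasure k S :=
  (lintegral_subtype_comap hS.measurableSet f).symm

theorem integrable_intrinsicMeasure (hS : IsC1Submanifold k S) {g : Eucl n → ℂ}
    (hg : Integrable g (surfaceMeasure k S)) :
    Integrable (fun ξ : S => g ξ) (intrinsicMeasure k S) := by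
  rw [surfaceMeasure, ← map_comap_subtype_coe hS.measurableSet,
    (MeasurableEmbedding.subtype_coe hS.measurableSet).integrable_map_iff] at hg
  exact hg

theorem extension_surfaceMeasure (hS : IsC1Submanifold k S) (g : Eucl n → ℂ) (x : Eucl n) :
    extension (surfaceMeasure k S) g x = ∫ ξ : S, g ξ *
      Complex.exp (-(2 * Real.pi * Complex.I * (⟪x, (ξ : Eucl n)⟫ : ℝ))) ∂intrinsicMeasure k S :=
  (integral_subtype_comap hS.measurableSet _).symm

theorem norm_exp_neg_two_pi_I_mul (t : ℝ) :
    ‖Complex.exp (-(2 * Real.pi * Complex.I * t))‖ = 1 := by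
  rw [show -(2 * Real.pi * Complex.I * t) = ((-(2 * Real.pi * t) : ℝ) : ℂ) * Complex.I by
    push_cast; ring]
  exact Complex.norm_exp_ofReal_mul_I _

theorem continuous_extension {σ : Measure (Eucl n)} {g : Eucl n → ℂ} (hg : Integrable g σ) :
    Continuous (extension σ g) := by
  refine continuous_of_dominated (bound := fun ξ => ‖g ξ‖) (fun x => ?_) (fun x => ?_) hg.norm ?_
  · refine hg.1.mul (Continuous.aestronglyMeasurable ?_)
    fun_prop
  · refine ae_of_all _ fun ξ => ?_
    rw [norm_mul, norm_exp_neg_two_pi_I_mul, mul_one]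
  · refine ae_of_all _ fun ξ => ?_
    fun_prop

/-- Plancherel's identity on the translates of a subspace `V` transverse to `S`: the extension of
`g` restricted to `V + y` is the Fourier transform of the density on `V` obtained by projecting
`g e^{-2πi y·ξ} dσ` to `V`. -/
theorem lintegral_enorm_extension_sq (hS : IsC1Submanifold k S) {g : Eucl n → ℂ}
    (hg : Integrable g (surfaceMeasure k S)) {V : Submodule ℝ (Eucl n)}
    (hVk : finrank ℝ V = k) (hT : TransverseLocal S V) (hG : TransverseGlobal S V) (y : Eucl n) :
    ∫⁻ x : V, ‖extension (surfaceMeasure k S) g (x + y)‖ₑ ^ 2 =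
      ∫⁻ ξ : S, ‖g ξ‖ₑ ^ 2 * (projJacobian V (tangentSpace S ξ))⁻¹ ∂intrinsicMeasure k S := by
  set J : S → ℝ≥0∞ := fun ξ => projJacobian V (tangentSpace S ξ) with hJ
  have hJm : Measurable J := (hS.continuous_projJacobian V).measurable
  have hJtop : ∀ ξ, J ξ ≠ ⊤ := fun ξ => projJacobian_ne_top _ _
  have hJ0 : ∀ ξ, J ξ ≠ 0 := fun ξ => projJacobian_ne_zero (hT ξ ξ.2)
  have hJr : ∀ ξ, (((J ξ).toReal : ℝ) : ℂ) ≠ 0 := fun ξ => by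
    exact_mod_cast (ENNReal.toReal_pos (hJ0 ξ) (hJtop ξ)).ne'
  have hf := hG.measurableEmbedding_projTo hS
  have hmap : ((intrinsicMeasure k S).withDensity J).map (projTo S V) =
      (volume : Measure V).restrict (range (projTo S V)) := by
    rw [← comap_projTo_volume hS hVk hT hG, hf.map_comap]
  set e : S → ℂ := fun ξ => Complex.exp (-(2 * Real.pi * Complex.I * (⟪y, (ξ : Eucl n)⟫ : ℝ)))
  have he : Continuous e := by fun_prop
  -- The density on `V` of the projected measure; it vanishes outside the projection of `S`.
  set G : S → ℂ := fun ξ => g ξ * e ξ * ((J ξ).toReal : ℂ)⁻¹ with hGdef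
  set h : V → ℂ := Function.extend (projTo S V) G 0 with hh
  have hhf : ∀ ξ, h (projTo S V ξ) = G ξ := fun ξ => hf.injective.extend_apply _ _ _
  have hh0 : ∀ v ∉ range (projTo S V), h v = 0 := fun v hv => Function.extend_apply' _ _ _ hv
  have hgi := integrable_intrinsicMeasure hS hg
  have hGi : Integrable (fun ξ => (J ξ).toReal • G ξ) (intrinsicMeasure k S) := by
    have : (fun ξ => (J ξ).toReal • G ξ) = fun ξ : S => g ξ * e ξ := by
      funext ξ
      rw [hGdef, Complex.real_smul]
      field_simp [hJr ξ]
    rw [this]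
    refine hgi.mul_bdd (c := 1) he.aestronglyMeasurable (ae_of_all _ fun ξ => ?_)
    exact (norm_exp_neg_two_pi_I_mul _).le
  have hhi : Integrable h := by
    rw [← integrableOn_iff_integrable_of_support_subset (s := range (projTo S V))
      (fun v hv => by_contra fun hv' => hv (hh0 v hv')), IntegrableOn, ← hmap,
      hf.integrable_map_iff, integrable_withDensity_iff_integrable_smul' hJm
      (ae_of_all _ fun ξ => (hJtop ξ).lt_top)]
    simpa only [Function.comp_apply, hhf] using hGi
  have hFourier : ∀ x : V, extension (surfaceMeasure k S) g (x + y) = 𝓕 h x := by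
    intro x
    rw [Real.fourier_eq', ← setIntegral_eq_integral_of_forall_compl_eq_zero
      (s := range (projTo S V)) (fun v hv => by rw [hh0 v hv, smul_zero]), ← hmap,
      hf.integral_map, integral_withDensity_eq_integral_toReal_smul hJm
      (ae_of_all _ fun ξ => (hJtop ξ).lt_top), extension_surfaceMeasure hS]
    refine integral_congr_ae (ae_of_all _ fun ξ => ?_)
    have hinner : ⟪projTo S V ξ, x⟫ = ⟪(x : Eucl n), (ξ : Eucl n)⟫ := by
      rw [real_inner_comm, projTo, Submodule.inner_orthogonalProjectionOnto_eq_of_mem_left]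
    simp only [hhf, hinner, hGdef, Complex.real_smul, smul_eq_mul]
    rw [inner_add_left, Complex.ofReal_add, mul_add, neg_add, Complex.exp_add]
    have h2 : ((-2 * Real.pi * ⟪(x : Eucl n), (ξ : Eucl n)⟫ : ℝ) : ℂ) * Complex.I =
        -(2 * Real.pi * Complex.I * (⟪(x : Eucl n), (ξ : Eucl n)⟫ : ℝ)) := by
      push_cast; ring
    rw [h2]
    have := hJr ξ
    field_simp
    rfl
  simp_rw [hFourier]
  rw [lintegral_enorm_fourier_sq hhi, ← setLIntegral_eq_of_support_subset
    (s := range (projTo S V)) (fun v hv => by_contra fun hv' => hv (by simp [hh0 v hv'])),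
    ← hmap, hf.lintegral_map, lintegral_withDensity_eq_lintegral_mul_non_measurable _ hJm
    (ae_of_all _ fun ξ => (hJtop ξ).lt_top)]
  refine lintegral_congr fun ξ => ?_
  have he1 : ‖e ξ‖ₑ = 1 := by
    rw [← ofReal_norm, norm_exp_neg_two_pi_I_mul, ENNReal.ofReal_one]
  have hJ1 : ‖((J ξ).toReal : ℂ)⁻¹‖ₑ = (J ξ)⁻¹ := by
    rw [enorm_inv (hJr ξ), ← ofReal_norm, Complex.norm_real, Real.norm_of_nonneg
      ENNReal.toReal_nonneg, ENNReal.ofReal_toReal (hJtop ξ)]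
  rw [Pi.mul_apply, hhf, hGdef, enorm_mul, enorm_mul, he1, hJ1, mul_one]
  calc J ξ * (‖g ξ‖ₑ * (J ξ)⁻¹) ^ 2 = ‖g ξ‖ₑ ^ 2 * (J ξ)⁻¹ * (J ξ * (J ξ)⁻¹) := by ring
    _ = _ := by rw [ENNReal.mul_inv_cancel (hJ0 ξ) (hJtop ξ), mul_one]

end Extension
end KPlane

end

/-! ### The adjoint plane transform and the identity -/

noncomputable section

namespace KPlane
section Grassmannian
open Module Filter

variable {k n : ℕ} {S : Set (Eucl n)}

theorem measurable_starProjection :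
    Measurable fun V : LinGrass k n => (V.1.starProjection : Eucl n →L[ℝ] Eucl n) :=
  comap_measurable _

theorem measurable_starProjection_apply :
    Measurable fun p : LinGrass k n × Eucl n => p.1.1.starProjection p.2 := by
  have h : Continuous fun q : (Eucl n →L[ℝ] Eucl n) × Eucl n => q.1 q.2 := by fun_prop
  exact h.measurable.comp ((measurable_starProjection.comp measurable_fst).prodMk measurable_snd)

theorem measurable_planeThrough :
    Measurable fun p : LinGrass k n × Eucl n => planeThrough p.1 p.2 := by
  refine Measurable.subtype_mk (measurable_fst.prodMk ?_)
  simp_rw [Submodule.starProjection_orthogonal_val]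
  exact measurable_snd.sub measurable_starProjection_apply

theorem planeThrough_add (V : LinGrass k n) {x : Eucl n} (hx : x ∈ V.1) (y : Eucl n) :
    planeThrough V (x + y) = planeThrough V y := by
  have h : V.1ᗮ.starProjection x = 0 := by
    rwa [Submodule.starProjection_apply_eq_zero_iff, Submodule.orthogonal_orthogonal]
  refine Subtype.ext (Prod.ext rfl ?_)
  change V.1ᗮ.starProjection (x + y) = V.1ᗮ.starProjection y
  rw [map_add, h, zero_add]

theorem planeThrough_starProjection (V : LinGrass k n) (x : Eucl n) :
    planeThrough V (V.1ᗮ.starProjection x) = planeThrough V x := by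
  conv_rhs => rw [← V.1.starProjection_add_starProjection_orthogonal x]
  rw [planeThrough_add V (V.1.starProjection_apply_mem x)]

theorem measurable_projJacobian_tangentSpace (hS : IsC1Submanifold k S) :
    Measurable fun p : LinGrass k n × S => projJacobian p.1.1 (tangentSpace S p.2) := by
  have h1 : Measurable fun p : LinGrass k n × S =>
      ((p.1.1.starProjection : Eucl n →L[ℝ] Eucl n), p.2) :=
    (measurable_starProjection.comp measurable_fst).prodMk measurable_snd
  have h2 := hS.continuous_normDet_domRestrict.measurable.comp h1
  exact ENNReal.measurable_ofReal.comp h2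

/-- The total weight that `u` gives to the affine planes with direction `V`, with respect to
Lebesgue measure in the translation parameter. -/
def directionWeight (u : AffGrass k n → ℝ≥0) (V : LinGrass k n) : ℝ≥0∞ :=
  ∫⁻ y : V.1ᗮ, u (planeThrough V y)

variable {u : AffGrass k n → ℝ≥0}

theorem measurable_coe_planeThrough (hu : Measurable u) :
    Measurable fun p : LinGrass k n × Eucl n => (u (planeThrough p.1 p.2) : ℝ≥0∞) :=
  (hu.comp measurable_planeThrough).coe_nnreal_ennreal

theorem measurable_coe_planeThrough_right (hu : Measurable u) (V : LinGrass k n) :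
    Measurable fun x => (u (planeThrough V x) : ℝ≥0∞) :=
  (measurable_coe_planeThrough hu).comp measurable_prodMk_left

theorem measurable_coe_planeThrough_left (hu : Measurable u) (x : Eucl n) :
    Measurable fun V : LinGrass k n => (u (planeThrough V x) : ℝ≥0∞) :=
  (measurable_coe_planeThrough hu).comp measurable_prodMk_right

/-- Integration over the fibres `V + y` of a function that is a multiple of `u` on each of them. -/
theorem lintegral_mul_planeThrough (hu : Measurable u) (V : LinGrass k n) {F : Eucl n → ℝ≥0∞}
    (hF : Measurable F) {a : ℝ≥0∞}
    (ha : ∀ y ∈ V.1ᗮ, u (planeThrough V y) ≠ 0 → ∫⁻ x : V.1, F (x + y) = a) :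
    ∫⁻ x, F x * u (planeThrough V x) = directionWeight u V * a := by
  have hum := measurable_coe_planeThrough_right hu V
  rw [lintegral_eq_lintegral_slices V.1 (F := fun x => F x * u (planeThrough V x)) (hF.mul hum),
    directionWeight, ← lintegral_mul_const a
      (f := fun y : V.1ᗮ => (u (planeThrough V y) : ℝ≥0∞)) (hum.comp measurable_subtype_coe)]
  refine lintegral_congr fun y => ?_
  simp_rw [planeThrough_add V (SetLike.coe_mem _)]
  rw [lintegral_mul_const' _ _ ENNReal.coe_ne_top, mul_comm]
  by_cases h : u (planeThrough V y) = 0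
  · simp [h]
  · rw [ha _ y.2 h]

/-- The fibres have infinite volume; cutting off to balls of the same volume in all of them
expresses `directionWeight u` through an integral over the fixed space `ℝⁿ`. -/
theorem measurable_directionWeight (hu : Measurable u) : Measurable (directionWeight u) := by
  set c : ℝ≥0∞ := volume (Metric.ball (0 : Eucl k) 1)
  have hc0 : c ≠ 0 := (Metric.measure_ball_pos _ _ one_pos).ne'
  have hctop : c ≠ ⊤ := measure_ball_lt_top.ne
  have hball : ∀ V : LinGrass k n, volume (Metric.ball (0 : V.1) 1) = c := fun V => by
    have b : V.1 ≃ₗᵢ[ℝ] Eucl k := ((stdOrthonormalBasis ℝ V.1).reindex (finCongr V.2)).repr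
    have := b.measurePreserving.measure_preimage (s := Metric.ball (0 : Eucl k) 1)
      Metric.isOpen_ball.measurableSet.nullMeasurableSet
    rw [b.preimage_ball, map_zero] at this
    exact this
  have hset : MeasurableSet {p : LinGrass k n × Eucl n | ‖p.1.1.starProjection p.2‖ < 1} :=
    measurableSet_lt measurable_starProjection_apply.norm measurable_const
  have hind : Measurable ({p : LinGrass k n × Eucl n | ‖p.1.1.starProjection p.2‖ < 1}.indicator
      (1 : LinGrass k n × Eucl n → ℝ≥0∞)) := measurable_one.indicator hset
  have key : ∀ V : LinGrass k n, directionWeight u V = (∫⁻ x : Eucl n,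
      {p : LinGrass k n × Eucl n | ‖p.1.1.starProjection p.2‖ < 1}.indicator 1 (V, x) *
        (u (planeThrough V x) : ℝ≥0∞)) * c⁻¹ := fun V => by
    have hindV : Measurable fun x : Eucl n =>
        {p : LinGrass k n × Eucl n | ‖p.1.1.starProjection p.2‖ < 1}.indicator
          (1 : LinGrass k n × Eucl n → ℝ≥0∞) (V, x) := hind.comp measurable_prodMk_left
    rw [lintegral_mul_planeThrough hu V (a := c) hindV, mul_assoc,
      ENNReal.mul_inv_cancel hc0 hctop, mul_one]
    intro y hy _
    rw [← hball V, ← lintegral_indicator_one Metric.isOpen_ball.measurableSet]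
    refine lintegral_congr fun x => ?_
    have hx : V.1.starProjection (x + y) = x := by
      rw [map_add, Submodule.starProjection_eq_self_iff.2 x.2,
        (Submodule.starProjection_apply_eq_zero_iff _).2 hy, add_zero]
    simp only [indicator, mem_ofPred_eq, hx, mem_ball_zero_iff, Submodule.coe_norm, Pi.one_apply]
  rw [funext key]
  exact ((hind.mul (measurable_coe_planeThrough hu)).lintegral_prod_right').mul_const _

/-- Change of variables for the projection `Tᗮ → Vᗮ`, which maps a translate of `Tᗮ` onto the
parameter space of the planes with direction `V`; its Jacobian is that of `T → V`. -/
theorem lintegral_planeThrough_orthogonal (hu : Measurable u) (V : LinGrass k n)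
    {T : Submodule ℝ (Eucl n)} (hTk : finrank ℝ T = k) (hT : T ⊓ V.1ᗮ = ⊥) (y : Eucl n) :
    ∫⁻ x : Tᗮ, (u (planeThrough V (x + y)) : ℝ≥0∞) =
      (projJacobian V.1 T)⁻¹ * directionWeight u V := by
  have hTV : finrank ℝ T = finrank ℝ V.1 := hTk.trans V.2.symm
  have hTV' : finrank ℝ Tᗮ = finrank ℝ V.1ᗮ := by
    have h1 := T.finrank_add_finrank_orthogonal
    have h2 := V.1.finrank_add_finrank_orthogonal
    omega
  let B : Tᗮ →ₗ[ℝ] V.1ᗮ := (V.1ᗮ.starProjection.toLinearMap.domRestrict Tᗮ).codRestrict V.1ᗮ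
    fun x => V.1ᗮ.starProjection_apply_mem _
  have hB : B.normDet = (V.1.starProjection.toLinearMap.domRestrict T).normDet :=
    (LinearMap.normDet_codRestrict _).trans (normDet_domRestrict_orthogonal hTV)
  have hum := measurable_coe_planeThrough_right hu V
  have h1 : ∀ x : Tᗮ, (u (planeThrough V (x + y)) : ℝ≥0∞) =
      u (planeThrough V ((B x : Eucl n) + V.1ᗮ.starProjection y)) := fun x => by
    have : (B x : Eucl n) = V.1ᗮ.starProjection x := rfl
    rw [this, ← map_add, planeThrough_starProjection]
  simp_rw [h1]
  have h2 := lintegral_comp_linearMap_of_normDet_ne_zero B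
    (hB ▸ normDet_domRestrict_ne_zero hT) hTV'
    (F := fun z => (u (planeThrough V ((z : Eucl n) + V.1ᗮ.starProjection y)) : ℝ≥0∞))
    (hum.comp (measurable_subtype_coe.add_const _))
  rw [h2, hB, projJacobian, directionWeight]
  congr 1
  exact lintegral_add_right_eq_self (fun z : V.1ᗮ => (u (planeThrough V z) : ℝ≥0∞))
    (V.1ᗮ.orthogonalProjectionOnto y)

/-- The plane transform of `T*u` over the translates of `Tᗮ`, for `T` transverse to the planes
charged by `u`. The value does not depend on the translate, which is why the supremum over
translates in `mainTheorem3` is harmless. -/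
theorem planeTransform_adjointPlaneTransform (hk : k ≤ n) (hu : Measurable u)
    {T : Submodule ℝ (Eucl n)} (hTk : finrank ℝ T = k)
    (hT : ∀ V y, u (planeThrough V y) ≠ 0 → T ⊓ V.1ᗮ = ⊥) (y : Eucl n) :
    planeTransform (adjointPlaneTransform hk u) Tᗮ y =
      ∫⁻ V, (projJacobian V.1 T)⁻¹ * directionWeight u V ∂grassMeasure hk := by
  have hm : Measurable fun p : Tᗮ × LinGrass k n =>
      (u (planeThrough p.2 ((p.1 : Eucl n) + y)) : ℝ≥0∞) :=
    (measurable_coe_planeThrough hu).comp (measurable_snd.prodMk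
      ((measurable_subtype_coe.comp measurable_fst).add_const y))
  simp only [planeTransform, adjointPlaneTransform]
  rw [lintegral_lintegral_swap hm.aemeasurable]
  refine lintegral_congr fun V => ?_
  by_cases h : ∀ z, u (planeThrough V z) = 0
  · simp [directionWeight, h]
  · push Not at h
    obtain ⟨z, hz⟩ := h
    exact lintegral_planeThrough_orthogonal hu V hTk (hT V z hz) y

end Grassmannian
end KPlane

end

theorem mainTheorem3 {k n : ℕ} (hk : k ≤ n)
    (S : Set (KPlane.Eucl n)) (hS : KPlane.IsC1Submanifold k S)
    (g : KPlane.Eucl n → ℂ) (hg : Integrable g (KPlane.surfaceMeasure k S))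
    (u : KPlane.AffGrass k n → ℝ≥0) (hu : Measurable u)
    (htrans : ∀ p : KPlane.AffGrass k n, u p ≠ 0 →
      KPlane.TransverseLocal S p.1.1.1 ∧ KPlane.TransverseGlobal S p.1.1.1)
    (w : KPlane.Eucl n → ℝ≥0∞) (hw : w = KPlane.adjointPlaneTransform hk u) :
    ∫⁻ x, ‖KPlane.extension (KPlane.surfaceMeasure k S) g x‖ₑ ^ 2 * w x =
      ∫⁻ ξ, ‖g ξ‖ₑ ^ 2 *
        (⨆ y : KPlane.tangentSpace S ξ,
          KPlane.planeTransform w (KPlane.tangentSpace S ξ)ᗮ y) ∂(KPlane.surfaceMeasure k S) := by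
  open KPlane in
  subst hw
  have hext : Measurable fun x => ‖extension (surfaceMeasure k S) g x‖ₑ ^ 2 :=
    (continuous_extension hg).enorm.measurable.pow_const 2
  have := hS.isLocallyFiniteMeasure
  have hgi := integrable_intrinsicMeasure hS hg
  have hdw := measurable_directionWeight hu
  have hJ := measurable_projJacobian_tangentSpace hS
  calc ∫⁻ x, ‖extension (surfaceMeasure k S) g x‖ₑ ^ 2 * adjointPlaneTransform hk u x
      = ∫⁻ x, ∫⁻ V, ‖extension (surfaceMeasure k S) g x‖ₑ ^ 2 * u (planeThrough V x)
          ∂grassMeasure hk := by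
        refine lintegral_congr fun x => ?_
        rw [adjointPlaneTransform, lintegral_const_mul _
          (measurable_coe_planeThrough_left hu x)]
    _ = ∫⁻ V, (∫⁻ x, ‖extension (surfaceMeasure k S) g x‖ₑ ^ 2 * u (planeThrough V x))
          ∂grassMeasure hk := by
        refine lintegral_lintegral_swap (Measurable.aemeasurable ?_)
        exact (hext.comp measurable_fst).mul
          ((measurable_coe_planeThrough hu).comp measurable_swap)
    _ = ∫⁻ V, ∫⁻ ξ : S, ‖g ξ‖ₑ ^ 2 * ((projJacobian V.1 (tangentSpace S ξ))⁻¹ *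
          directionWeight u V) ∂intrinsicMeasure k S ∂grassMeasure hk := by
        refine lintegral_congr fun V => ?_
        rw [lintegral_mul_planeThrough hu V hext fun y _ hy =>
          lintegral_enorm_extension_sq hS hg V.2 (htrans _ hy).1 (htrans _ hy).2 y,
          ← lintegral_const_mul'']
        · refine lintegral_congr fun ξ => ?_
          ring
        · exact (hgi.1.aemeasurable.enorm.pow_const 2).mul
            (hJ.comp measurable_prodMk_left).inv.aemeasurable
    _ = ∫⁻ ξ : S, ∫⁻ V, ‖g ξ‖ₑ ^ 2 * ((projJacobian V.1 (tangentSpace S ξ))⁻¹ *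
          directionWeight u V) ∂grassMeasure hk ∂intrinsicMeasure k S := by
        refine lintegral_lintegral_swap ?_
        refine (AEMeasurable.comp_snd (hgi.1.aemeasurable.enorm.pow_const 2)).mul ?_
        exact (hJ.inv.mul (hdw.comp measurable_fst)).aemeasurable
    _ = _ := by
        rw [lintegral_surfaceMeasure hS]
        refine lintegral_congr fun ξ => ?_
        have hJξ : Measurable fun V : LinGrass k n =>
            (projJacobian V.1 (tangentSpace S ξ))⁻¹ * directionWeight u V :=
          (hJ.comp measurable_prodMk_right).inv.mul hdw
        rw [lintegral_const_mul _ hJξ]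
        congr 1
        simp_rw [planeTransform_adjointPlaneTransform hk hu (hS.finrank_tangentSpace ξ.2)
          fun V y hy => (htrans _ hy).1 ξ ξ.2]
        rw [ciSup_const]
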